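/- Let $K$ be a field that is finitely generated over its prime field, let $v : K \to \mathbb{R}_{\ge 0}$ be a discrete valuation of $K$ (written multiplicatively; its value group is infinite cyclic), let $K_v$ be the completion of $K$ with respect to $v$, and let $E/K$ be a finite extension, not necessarily separable, of separable degree $[E:K]_{\mathrm{s}}$. (i) There are at most $[E:K]_{\mathrm{s}}$ valuations $w : E \to \mathbb{R}_{\ge 0}$ extending $v$ (that is, with $w|_K = v$). (ii) For each such $w$ let $E_w$ be the completion of $E$ with respect to $w$, regarded as a $K_v$-algebra through the continuous extension $K_v \to E_w$ of the inclusion $K \to E$. Assume that $E/K$ is separable, or that the valuation ring $O_v = \{x \in K : v(x) \le 1\}$ is a localization of a finitely generated $\mathbb{Z}$-algebra. (If $K$ has characteristic $p > 0$, the latter says that $O_v$ is a localization of a finitely generated $\mathbb{F}_p$-algebra; it holds, for example, for the valuations given by the closed points of a smooth curve with function field $K$ over a field of constants that is finitely generated over $\mathbb{F}_p$.) Then there is an isomorphism of $K_v$-algebras $$K_v \otimes_K E \;\cong\; \prod_{w \mid v} E_w .$$ -/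

import Mathlib

open scoped NNReal TensorProduct

namespace Valuation

section

variable {K : Type*} [Field K] (v : Valuation K ℝ≥0)

/-- The inclusion of `K` into its completion `K_v`. -/
noncomputable def toCompletion : K →+* v.Completion :=
  (UniformSpace.Completion.coeRingHom : WithVal v →+* v.Completion).comp
    ((WithVal.equiv v).symm : K →+* WithVal v)

/-- `K_v` as a `K`-algebra. -/
noncomputable instance algebraCompletion : Algebra K v.Completion :=
  v.toCompletion.toAlgebra

/-- The set of the real-valued valuations `w` of `E` that extend `v`, that is, whose restriction
to `K` is equal to `v`. -/
noncomputable def extensions (E : Type*) [Field E] [Algebra K E] : Set (Valuation E ℝ≥0) :=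
  {w | w.comap (algebraMap K E) = v}

variable {E : Type*} [Field E] [Algebra K E]

/-- The inclusion `K → E`, where `K` carries the topology of `v` and `E` that of `w`. -/
noncomputable def withValMap (w : Valuation E ℝ≥0) : WithVal v →+* WithVal w :=
  ((WithVal.equiv w).symm : E →+* WithVal w).comp
    ((algebraMap K E).comp (WithVal.equiv v : WithVal v →+* K))

theorem exists_ne_zero_and_lt [hv : v.IsRankOneDiscrete] (r : ℝ≥0) (hr : 0 < r) :
    ∃ x : K, x ≠ 0 ∧ v x < r := by
  obtain ⟨x, hx⟩ := IsRankOneDiscrete.generator_mem_range K v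
  have h1 : v x < 1 := by
    rw [hx]
    exact_mod_cast IsRankOneDiscrete.generator_lt_one v
  have h0 : x ≠ 0 := by
    rintro rfl
    rw [map_zero] at hx
    exact IsRankOneDiscrete.generator_ne_zero v hx.symm
  obtain ⟨n, hn⟩ := exists_pow_lt_of_lt_one hr h1
  exact ⟨x ^ n, pow_ne_zero n h0, by rwa [map_pow]⟩

theorem continuous_withValMap [v.IsRankOneDiscrete] (w : Valuation E ℝ≥0)
    (hw : w.comap (algebraMap K E) = v) : Continuous (withValMap v w) := by
  refine continuous_of_continuousAt_zero (withValMap v w) ?_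
  rw [ContinuousAt, map_zero, (Valued.hasBasis_nhds_zero _ _).tendsto_iff
    (Valued.hasBasis_nhds_zero _ _)]
  intro γ _
  obtain ⟨x, hx0, hx⟩ := v.exists_ne_zero_and_lt
    (MonoidWithZeroHom.ValueGroup₀.embedding γ.1)
    (by
      have h := MonoidWithZeroHom.ValueGroup₀.embedding_strictMono (Units.zero_lt γ)
      rwa [map_zero] at h)
  have hx0' : Valued.v.restrict ((WithVal.equiv v).symm x) ≠ 0 := by
    rw [Ne, restrict_eq_zero_iff]
    exact (v.ne_zero_iff).2 hx0
  refine ⟨Units.mk0 _ hx0', trivial, fun y hy ↦ ?_⟩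
  have hy' : v (WithVal.equiv v y) < v x :=
    (restrict_lt_iff (Valued.v : Valuation (WithVal v) ℝ≥0)).1 hy
  refine (restrict_lt_iff_lt_embedding _).2 ?_
  have hwy : w (algebraMap K E (WithVal.equiv v y)) = v (WithVal.equiv v y) :=
    congrArg (fun u : Valuation K ℝ≥0 ↦ u (WithVal.equiv v y)) hw
  exact (hwy.trans_lt hy').trans hx

/-- The ring homomorphism `K_v → E_w` that extends the inclusion `K → E` by continuity. -/
noncomputable def completionMap [v.IsRankOneDiscrete] (w : v.extensions E) :
    v.Completion →+* w.1.Completion :=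
  UniformSpace.Completion.mapRingHom (withValMap v w.1) (continuous_withValMap v w.1 w.2)

/-- `E_w` as a `K_v`-algebra, for an extension `w` of `v`. -/
noncomputable instance algebraCompletionExtension [v.IsRankOneDiscrete] (w : v.extensions E) :
    Algebra v.Completion w.1.Completion :=
  (completionMap v w).toAlgebra

end

end Valuation

/-!
The `K_v`-algebra `K_v ⊗ E` is finite, so each of its residue fields is a complete field with a
unique norm extending that of `K_v`. Restricting this norm to `E` gives an extension of `v`, and
conversely `E_w` is a quotient of `K_v ⊗ E`, because the image is closed and contains the dense
subfield `E`. Since `E` is dense in `K_v ⊗ E`, this makes the extensions of `v` correspond to the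
maximal ideals of `K_v ⊗ E`. Every maximal ideal is the kernel of a homomorphism to an algebraic
closure of `K_v`, which is determined by its restriction to `E`, so their number is at most the
separable degree. If `K_v ⊗ E` is reduced, then, being Artinian, it is the product of its residue
fields `E_w`.

For separable `E` the algebra `K_v ⊗ E` is étale over `K_v`. If `O_v` is finite over its `p`-th
powers, then an additive retraction of the Frobenius of `E` which is linear over the inverse of the
Frobenius of `K` is bounded. Hence the `p`-th powers of the coordinates of `x` in a basis of `E`
are bounded by a constant times the coordinates of `x ^ p`. By density this estimate extends to
`K_v ⊗ E`, where it rules out nilpotent elements.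
-/

namespace ValuationExtension

open Valuation hiding norm_eq_zero
open scoped Valued

section TensorProduct

variable (K E L : Type*) [Field K] [Field E] [Algebra K E] [FiniteDimensional K E] [Field L]
  [Algebra K L]

theorem card_maximalSpectrum_tensorProduct_le_finSepDegree :
    ENat.card (MaximalSpectrum (L ⊗[K] E)) ≤ Field.finSepDegree K E := by
  let Ω := AlgebraicClosure L
  have exists_algHom (m : MaximalSpectrum (L ⊗[K] E)) :
      ∃ φ : L ⊗[K] E →ₐ[L] Ω, RingHom.ker φ = m.asIdeal := by
    let : Field ((L ⊗[K] E) ⧸ m.asIdeal) := Ideal.Quotient.field m.asIdeal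
    refine ⟨(IsAlgClosed.lift (R := L) (S := (L ⊗[K] E) ⧸ m.asIdeal)).comp
      (Ideal.Quotient.mkₐ L m.asIdeal), ?_⟩
    ext z
    simp [RingHom.mem_ker, Ideal.Quotient.eq_zero_iff_mem]
  choose φ hφ using exists_algHom
  have restrict_injective : Function.Injective fun m ↦
      ((φ m).restrictScalars K).comp
        (Algebra.TensorProduct.includeRight : E →ₐ[K] L ⊗[K] E) := by
    intro m m' hmm'
    have : φ m = φ m' := Algebra.TensorProduct.ext_ring hmm'
    exact MaximalSpectrum.ext (by rw [← hφ m, ← hφ m', this])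
  calc ENat.card (MaximalSpectrum (L ⊗[K] E)) ≤ ENat.card (E →ₐ[K] Ω) :=
        ENat.card_le_card_of_injective restrict_injective
    _ = Field.finSepDegree K E := by
        rw [Field.finSepDegree_eq_of_isAlgClosed K E Ω, ENat.card_eq_coe_natCard]

theorem isReduced_tensorProduct_of_isSeparable [Algebra.IsSeparable K E] :
    IsReduced (L ⊗[K] E) :=
  have := Algebra.FormallyUnramified.of_isSeparable K E
  Algebra.FormallyUnramified.isReduced_of_field L (L ⊗[K] E)

end TensorProduct

section Density

theorem tensorProduct_induction_of_denseRange {K L E ι : Type*} [CommRing K] [CommRing L]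
    [TopologicalSpace L] [Algebra K L] (hL : DenseRange (algebraMap K L)) [AddCommGroup E]
    [Module K E] [Fintype ι] (b : Module.Basis ι K E) {P : L ⊗[K] E → Prop}
    (isClosed : IsClosed {c : ι → L | P (∑ i, c i • b.baseChange L i)})
    (one_tmul : ∀ x : E, P (1 ⊗ₜ x)) (z : L ⊗[K] E) : P z := by
  rw [← (b.baseChange L).sum_repr z]
  refine (DenseRange.piMap fun _ ↦ hL).induction_on
    (p := fun c ↦ P (∑ i, c i • b.baseChange L i)) _ isClosed fun a ↦ ?_
  simpa only [Pi.map_apply, algebraMap_smul, Module.Basis.baseChange_apply,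
    ← TensorProduct.tmul_smul, ← TensorProduct.tmul_sum] using one_tmul (∑ i, a i • b i)

theorem norm_eq_norm_of_forall_one_tmul {K L E M N : Type*} [Field K] [NontriviallyNormedField L]
    [Algebra K L] (hL : DenseRange (algebraMap K L)) [AddCommGroup E] [Module K E]
    [FiniteDimensional K E] [NormedAddCommGroup M] [NormedSpace L M] [NormedAddCommGroup N]
    [NormedSpace L N] (f : L ⊗[K] E →ₗ[L] M) (g : L ⊗[K] E →ₗ[L] N)
    (h : ∀ x : E, ‖f (1 ⊗ₜ x)‖ = ‖g (1 ⊗ₜ x)‖) (z : L ⊗[K] E) : ‖f z‖ = ‖g z‖ := by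
  refine tensorProduct_induction_of_denseRange (P := fun z ↦ ‖f z‖ = ‖g z‖) hL
    (Module.finBasis K E) ?_ h z
  simp only [map_sum, map_smul]
  exact isClosed_eq (by fun_prop) (by fun_prop)

end Density

section FFinite

theorem finite_of_essFiniteType_of_isIntegral {R S : Type*} [CommRing R] [CommRing S]
    {f : R →+* S} (hf : f.EssFiniteType) (hf' : f.IsIntegral) : f.Finite := by
  algebraize [f]
  let A := Algebra.EssFiniteType.subalgebra R S
  have : Algebra.IsIntegral R A := .of_injective A.val Subtype.val_injective
  have : Algebra.IsIntegral A S := .tower_top R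
  have isUnit_of_mem_submonoid : Algebra.EssFiniteType.submonoid R S ≤ IsUnit.submonoid A :=
    fun a ha ↦ isUnit_of_map_unit (algebraMap A S) a ha
  have : Module.Finite R A := Algebra.IsIntegral.finite
  exact Module.Finite.equiv ((IsLocalization.atUnits A (Algebra.EssFiniteType.submonoid R S)
    isUnit_of_mem_submonoid).restrictScalars R).toLinearEquiv

/-- A commutative ring is *F-finite* if it is finite as a module over itself through the Frobenius
endomorphism `x ↦ x ^ p`, where `p` is the characteristic exponent of the ring. For `p = 1` this is
no condition. -/
def IsFFinite (R : Type*) [CommRing R] : Prop :=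
  ∃ (p : ℕ) (_ : ExpChar R p), (frobenius R p).Finite

open Polynomial in
theorem isFFinite_of_essFiniteType_int {R : Type*} [CommRing R] [IsDomain R]
    (hR : Algebra.EssFiniteType ℤ R) : IsFFinite R := by
  obtain ⟨p, hp⟩ := ExpChar.exists R
  refine ⟨p, hp, ?_⟩
  have essFiniteType : (frobenius R p).EssFiniteType := by
    refine RingHom.EssFiniteType.of_comp (algebraMap ℤ R) ?_
    rw [Subsingleton.elim ((frobenius R p).comp (algebraMap ℤ R)) (algebraMap ℤ R)]
    exact RingHom.essFiniteType_algebraMap.2 hR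
  have isIntegral : (frobenius R p).IsIntegral := fun x ↦
    ⟨X ^ p - C x, monic_X_pow_sub_C x (expChar_pos R p).ne', by simp [frobenius_def]⟩
  exact finite_of_essFiniteType_of_isIntegral essFiniteType isIntegral

theorem exists_finset_forall_eq_sum_map_mul {A B : Type*} [CommRing A] [CommRing B]
    {f : A →+* B} (hf : f.Finite) : ∃ s : Finset B, ∀ x, ∃ a : B → A, x = ∑ m ∈ s, f (a m) * m := by
  algebraize [f]
  obtain ⟨s, hs⟩ := Module.Finite.fg_top (R := A) (M := B)
  refine ⟨s, fun x ↦ ?_⟩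
  obtain ⟨a, -, ha⟩ := Submodule.mem_span_finset.1 (hs ▸ Submodule.mem_top : x ∈ _)
  exact ⟨a, ha.symm⟩

end FFinite

theorem exists_leftInverse_of_injective_semilinear {K L V W : Type*} [DivisionRing K] [Semiring L]
    {σ : K →+* L} [AddCommGroup V] [Module K V] [AddCommGroup W] [Module L W] (f : V →ₛₗ[σ] W)
    (hf : Function.Injective f) :
    ∃ r : W →+ V, (∀ x, r (f x) = x) ∧ ∀ (a : K) (y : W), r (σ a • y) = a • r y := by
  let : Module K W := .compHom W σ
  let g : V →ₗ[K] W := { f with map_smul' := f.map_smul' }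
  obtain ⟨r, hr⟩ := g.exists_leftInverse_of_injective (LinearMap.ker_eq_bot.2 hf)
  exact ⟨r, LinearMap.congr_fun hr, r.map_smul⟩

section Bounded

variable {K Γ₀ : Type*} [Field K] [LinearOrderedCommGroupWithZero Γ₀]

theorem exists_map_le_pow_le [MulArchimedean Γ₀] (v : Valuation K Γ₀) [v.IsNontrivial]
    {p : ℕ} (hp : p ≠ 0) : ∃ D, ∀ x ≠ 0, ∃ y ≠ 0, v x ≤ v y ^ p ∧ v y ^ p ≤ D * v x := by
  obtain ⟨t, ht⟩ := IsNontrivial.exists_one_lt (v := v)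
  have ht0 : v t ≠ 0 := (zero_lt_one.trans ht).ne'
  refine ⟨v t ^ p, fun x hx ↦ ?_⟩
  have one_lt_unit : 1 < Units.mk0 (v t ^ p) (pow_ne_zero p ht0) := by
    exact_mod_cast one_lt_pow₀ ht hp
  obtain ⟨n, ⟨hn, hn'⟩, -⟩ := existsUnique_zpow_near_of_one_lt one_lt_unit
    (Units.mk0 (v x) (v.ne_zero_iff.2 hx))
  have pow_eq : v (t ^ (n + 1)) ^ p = (v t ^ p) ^ (n + 1) := by
    rw [map_zpow₀, ← zpow_natCast, ← zpow_natCast, zpow_comm]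
  refine ⟨t ^ (n + 1), zpow_ne_zero _ (v.ne_zero_iff.1 ht0), ?_, ?_⟩
  · rw [pow_eq]
    simpa using Units.val_le_val.2 hn'.le
  · rw [pow_eq, zpow_add_one₀ (pow_ne_zero p ht0), mul_comm]
    gcongr
    simpa using Units.val_le_val.2 hn

theorem exists_forall_map_pow_le_of_frobenius_finite [MulArchimedean Γ₀] (v : Valuation K Γ₀)
    [v.IsNontrivial] {p : ℕ} [ExpChar v.valuationSubring p]
    (hp : (frobenius v.valuationSubring p).Finite) (φ : K →+ K)
    (hφ : ∀ a x, φ (a ^ p * x) = a * φ x) : ∃ C, ∀ x, v (φ x) ^ p ≤ C * v x := by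
  obtain ⟨s, hs⟩ := exists_finset_forall_eq_sum_map_mul hp
  obtain ⟨D, hD⟩ := exists_map_le_pow_le v (expChar_pos v.valuationSubring p).ne'
  let C := s.sup fun m ↦ v (φ m)
  have map_le_of_integer (x : v.valuationSubring) : v (φ x) ≤ C := by
    obtain ⟨a, ha⟩ := hs x
    rw [ha, AddSubmonoidClass.coe_finsetSum, map_sum]
    refine v.map_sum_le fun m hm ↦ ?_
    calc v (φ (a m ^ p * m)) = v (a m) * v (φ m) := by rw [hφ, map_mul]
      _ ≤ 1 * C := by
        gcongr
        · exact (a m).2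
        · exact Finset.le_sup (f := fun m : v.valuationSubring ↦ v (φ m)) hm
      _ = C := one_mul C
  refine ⟨C ^ p * D, fun x ↦ ?_⟩
  rcases eq_or_ne x 0 with rfl | hx
  · simp [(expChar_pos v.valuationSubring p).ne']
  -- Dividing by a `p`-th power of the right size moves `x` into the valuation ring, where `φ` is
  -- bounded by its values on the finitely many generators.
  obtain ⟨y, hy, hxy, hyx⟩ := hD x hx
  have quotient_mem : x / y ^ p ∈ v.valuationSubring := by
    change v (x / y ^ p) ≤ 1
    rw [map_div₀, map_pow]
    exact div_le_one_of_le₀ hxy zero_le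
  calc v (φ x) ^ p = (v y * v (φ (x / y ^ p))) ^ p := by
        rw [← map_mul, ← hφ, mul_div_cancel₀ _ (pow_ne_zero p hy)]
    _ ≤ (v y * C) ^ p := by
        gcongr
        exact map_le_of_integer ⟨_, quotient_mem⟩
    _ = C ^ p * v y ^ p := by rw [mul_pow, mul_comm]
    _ ≤ C ^ p * (D * v x) := by gcongr
    _ = C ^ p * D * v x := (mul_assoc ..).symm

theorem exists_forall_repr_pow_le_sum (v : Valuation K ℝ≥0) [v.IsNontrivial] {p : ℕ}
    [ExpChar v.valuationSubring p] (hp : (frobenius v.valuationSubring p).Finite) {E ι : Type*}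
    [CommRing E] [Nontrivial E] [IsReduced E] [Algebra K E] [Fintype ι] (b : Module.Basis ι K E) :
    ∃ C : ι → ι → ℝ≥0, ∀ x j, v (b.repr x j) ^ p ≤ ∑ i, C i j * v (b.repr (x ^ p) i) := by
  have : ExpChar K p := expChar_of_injective_ringHom v.valuationSubring.subtype_injective p
  have : ExpChar E p := expChar_of_injective_algebraMap (algebraMap K E).injective p
  obtain ⟨r, r_pow, r_smul⟩ := exists_leftInverse_of_injective_semilinear
    (LinearMap.frobenius K E p) (frobenius_inj E p)
  let φ (i j : ι) : K →+ K :=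
    (b.coord j).toAddMonoidHom.comp (r.comp (LinearMap.toSpanSingleton K E (b i)).toAddMonoidHom)
  have hφ (i j : ι) (a x : K) : φ i j (a ^ p * x) = a * φ i j x := by
    have := congrArg (b.coord j) (r_smul a (x • b i))
    simpa [φ, mul_smul, frobenius_def] using this
  choose C hC using fun i j ↦ exists_forall_map_pow_le_of_frobenius_finite v hp (φ i j) (hφ i j)
  refine ⟨C, fun x j ↦ ?_⟩
  have repr_eq : b.repr x j = ∑ i, φ i j (b.repr (x ^ p) i) := by
    have : x = ∑ i, r (b.repr (x ^ p) i • b i) := by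
      rw [← map_sum, b.sum_repr]
      exact (r_pow x).symm
    conv_lhs => rw [this]
    simp [φ]
  have : Nonempty ι := ⟨j⟩
  obtain ⟨k, hk⟩ := Finite.exists_max fun i ↦ v (φ i j (b.repr (x ^ p) i))
  calc v (b.repr x j) ^ p ≤ v (φ k j (b.repr (x ^ p) k)) ^ p := by
        rw [repr_eq]
        exact pow_le_pow_left' (v.map_sum_le fun i _ ↦ hk i) p
    _ ≤ C k j * v (b.repr (x ^ p) k) := hC k j _
    _ ≤ ∑ i, C i j * v (b.repr (x ^ p) i) :=
        Finset.single_le_sum (f := fun i ↦ C i j * v (b.repr (x ^ p) i)) (fun _ _ ↦ zero_le)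
          (Finset.mem_univ k)

end Bounded

section Completion

variable {K : Type*} [Field K] (v : Valuation K ℝ≥0)

theorem valued_toCompletion (x : K) : (Valued.v (v.toCompletion x) : ℝ≥0) = v x :=
  Valued.valuedCompletion_apply _

theorem denseRange_toCompletion : DenseRange v.toCompletion :=
  (UniformSpace.Completion.denseRange_coe (α := WithVal v)).comp
    (WithVal.toVal_surjective v).denseRange (UniformSpace.Completion.continuous_coe _)

/-- The values of a nontrivial real-valued valuation on its completion, taken as they are, as a
norm. -/
noncomputable instance rankOneCompletion [v.IsNontrivial] :
    RankOne (Valued.v : Valuation v.Completion ℝ≥0) where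
  hom' := MonoidWithZeroHom.ValueGroup₀.embedding
  strictMono' := MonoidWithZeroHom.ValueGroup₀.embedding_strictMono
  exists_val_nontrivial := by
    obtain ⟨x, hx⟩ := IsNontrivial.exists_val_nontrivial (v := v)
    exact ⟨v.toCompletion x, by rwa [valued_toCompletion]⟩

theorem norm_toCompletion [v.IsNontrivial] (x : K) : ‖v.toCompletion x‖ = v x := by
  rw [← valued_toCompletion]
  exact congrArg NNReal.toReal (embedding_restrict Valued.v _)

theorem exists_forall_norm_repr_pow_le_sum [v.IsNontrivial] {p : ℕ}
    [ExpChar v.valuationSubring p] (hp : (frobenius v.valuationSubring p).Finite) {E ι : Type*}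
    [CommRing E] [Nontrivial E] [IsReduced E] [Algebra K E] [Fintype ι] (b : Module.Basis ι K E) :
    ∃ C : ι → ι → ℝ≥0, ∀ (z : v.Completion ⊗[K] E) (j : ι),
      ‖(b.baseChange v.Completion).repr z j‖ ^ p ≤
        ∑ i, C i j * ‖(b.baseChange v.Completion).repr (z ^ p) i‖ := by
  have : ExpChar K p := expChar_of_injective_ringHom v.valuationSubring.subtype_injective p
  have : ExpChar (v.Completion ⊗[K] E) p :=
    expChar_of_injective_algebraMap (algebraMap K (v.Completion ⊗[K] E)).injective p
  obtain ⟨C, hC⟩ := exists_forall_repr_pow_le_sum v hp b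
  refine ⟨C, fun z j ↦ ?_⟩
  refine tensorProduct_induction_of_denseRange (P := fun z ↦
      ‖(b.baseChange v.Completion).repr z j‖ ^ p ≤
        ∑ i, C i j * ‖(b.baseChange v.Completion).repr (z ^ p) i‖)
    (denseRange_toCompletion v) b ?_ (fun x ↦ ?_) z
  · have sum_pow (c : ι → v.Completion) :
        (∑ i, c i • b.baseChange v.Completion i) ^ p =
          ∑ i, c i ^ p • b.baseChange v.Completion i ^ p := by
      simpa only [frobenius_def, smul_pow] using
        map_sum (frobenius (v.Completion ⊗[K] E) p) (fun i ↦ c i • b.baseChange v.Completion i)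
          Finset.univ
    simp only [sum_pow, map_sum, map_smul, Finsupp.coe_finsetSum,
      Finsupp.coe_smul, Finset.sum_apply, Pi.smul_apply]
    exact isClosed_le (by fun_prop) (by fun_prop)
  · have repr_one_tmul (x : E) (i : ι) :
        (b.baseChange v.Completion).repr (1 ⊗ₜ x) i = v.toCompletion (b.repr x i) := by
      rw [Module.Basis.baseChange_repr_tmul, Algebra.smul_def, mul_one]
      rfl
    simp only [Algebra.TensorProduct.tmul_pow, one_pow, repr_one_tmul, norm_toCompletion]
    exact_mod_cast hC x j

theorem isReduced_tensorProduct_of_isFFinite [v.IsNontrivial] (hv : IsFFinite v.valuationSubring)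
    (E : Type*) [Field E] [Algebra K E] [FiniteDimensional K E] :
    IsReduced (v.Completion ⊗[K] E) := by
  obtain ⟨p, _, hp⟩ := hv
  have : ExpChar K p := expChar_of_injective_ringHom v.valuationSubring.subtype_injective p
  obtain hp_prime | rfl := expChar_is_prime_or_one K p
  · let b := Module.finBasis K E
    obtain ⟨C, hC⟩ := exists_forall_norm_repr_pow_le_sum v hp b
    refine (isReduced_iff_pow_one_lt p hp_prime.one_lt).2 fun z hz ↦
      (b.baseChange v.Completion).ext_elem fun j ↦ ?_
    have : ‖(b.baseChange v.Completion).repr z j‖ ^ p ≤ 0 := by simpa [hz] using hC z j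
    simpa using eq_zero_of_pow_eq_zero (this.antisymm (by positivity))
  · have : CharZero K := charZero_of_expChar_one' K
    exact isReduced_tensorProduct_of_isSeparable K E v.Completion

end Completion

section Lift

variable {K L E M : Type*} [CommRing K] [CommRing L] [Algebra K L] [CommRing E] [Algebra K E]
  [CommRing M] [Algebra L M] (f : E →+* M)
  (hf : ∀ x, f (algebraMap K E x) = algebraMap L M (algebraMap K L x))

/-- The homomorphism of `L`-algebras `L ⊗ E → M` that extends a ring homomorphism `E → M`
compatible with `K → L → M`. Unlike in `Algebra.TensorProduct.lift`, no `K`-algebra structure on `M`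
is part of the data: the completions carry a second, not definitionally equal, action of `K`. -/
noncomputable def tensorProductLift : L ⊗[K] E →ₐ[L] M :=
  letI : Algebra K M := ((algebraMap L M).comp (algebraMap K L)).toAlgebra
  haveI : IsScalarTower K L M := .of_algebraMap_eq fun _ ↦ rfl
  Algebra.TensorProduct.lift (Algebra.ofId L M) (⟨f, hf⟩ : E →ₐ[K] M) fun _ _ ↦ .all _ _

theorem tensorProductLift_one_tmul (x : E) : tensorProductLift f hf (1 ⊗ₜ x) = f x := by
  let : Algebra K M := ((algebraMap L M).comp (algebraMap K L)).toAlgebra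
  have : IsScalarTower K L M := .of_algebraMap_eq fun _ ↦ rfl
  simpa only [map_one, one_mul] using! Algebra.TensorProduct.lift_tmul (Algebra.ofId L M)
    (⟨f, hf⟩ : E →ₐ[K] M) (fun _ _ ↦ .all _ _) 1 x

end Lift

section Extension

variable {K : Type*} [Field K] (v : Valuation K ℝ≥0) {E : Type*} [Field E] [Algebra K E]

theorem extensions_apply_algebraMap (w : v.extensions E) (x : K) :
    w.1 (algebraMap K E x) = v x :=
  congrArg (fun u : Valuation K ℝ≥0 ↦ u x) w.2

instance isNontrivial_extensions [v.IsNontrivial] (w : v.extensions E) : w.1.IsNontrivial := by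
  obtain ⟨x, hx⟩ := IsNontrivial.exists_val_nontrivial (v := v)
  exact ⟨algebraMap K E x, by rwa [extensions_apply_algebraMap]⟩

variable [v.IsRankOneDiscrete] (w : v.extensions E)

theorem completionMap_toCompletion (x : K) :
    v.completionMap w (v.toCompletion x) = w.1.toCompletion (algebraMap K E x) :=
  UniformSpace.Completion.mapRingHom_coe (continuous_withValMap v w.1 w.2) _

theorem norm_completionMap (x : v.Completion) : ‖v.completionMap w x‖ = ‖x‖ := by
  have continuous_completionMap : Continuous (v.completionMap w) :=
    UniformSpace.Completion.continuous_map
  refine (denseRange_toCompletion v).induction_on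
    (p := fun x ↦ ‖v.completionMap w x‖ = ‖x‖) x
    (isClosed_eq (by fun_prop) (by fun_prop)) fun x ↦ ?_
  rw [completionMap_toCompletion, norm_toCompletion, norm_toCompletion,
    extensions_apply_algebraMap]

/-- `E_w` as a normed `K_v`-algebra. -/
noncomputable instance normedAlgebraCompletion :
    NormedAlgebra v.Completion w.1.Completion where
  __ := v.algebraCompletionExtension w
  norm_smul_le c x := by
    rw [Algebra.smul_def, norm_mul]
    exact (congrArg (· * ‖x‖) (norm_completionMap v w c)).le

/-- The canonical homomorphism `K_v ⊗ E → E_w` of `K_v`-algebras. -/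
noncomputable def tensorToCompletion : v.Completion ⊗[K] E →ₐ[v.Completion] w.1.Completion :=
  tensorProductLift w.1.toCompletion fun x ↦ (completionMap_toCompletion v w x).symm

theorem tensorToCompletion_one_tmul (x : E) :
    tensorToCompletion v w (1 ⊗ₜ x) = w.1.toCompletion x :=
  tensorProductLift_one_tmul ..

variable [FiniteDimensional K E]

theorem tensorToCompletion_surjective : Function.Surjective (tensorToCompletion v w) := by
  let range : Submodule v.Completion w.1.Completion := (tensorToCompletion v w).toLinearMap.range
  have isClosed : IsClosed (range : Set w.1.Completion) := range.closed_of_finiteDimensional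
  have dense : Dense (range : Set w.1.Completion) := (denseRange_toCompletion w.1).mono (by
    rintro _ ⟨x, rfl⟩
    exact ⟨1 ⊗ₜ x, tensorToCompletion_one_tmul v w x⟩)
  exact fun y ↦ isClosed.closure_subset (dense y)

end Extension

section MaximalSpectrum

theorem norm_eq_norm_of_ker_le {K A L M : Type*} [NontriviallyNormedField K] [CompleteSpace K]
    [IsUltrametricDist K] [CommRing A] [Algebra K A] [NormedField L] [NormedAlgebra K L]
    [Algebra.IsAlgebraic K L] [IsUltrametricDist L] [NormedField M] [NormedAlgebra K M]
    [Algebra.IsAlgebraic K M] [IsUltrametricDist M] (f : A →ₐ[K] L) (g : A →ₐ[K] M)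
    (h : RingHom.ker f ≤ RingHom.ker g) (x : A) : ‖f x‖ = ‖g x‖ := by
  have aeval_minpoly_mem_ker : Polynomial.aeval x (minpoly K (f x)) ∈ RingHom.ker f := by
    rw [RingHom.mem_ker, ← Polynomial.aeval_algHom_apply, minpoly.aeval]
  have minpoly_eq : minpoly K (f x) = minpoly K (g x) := by
    refine minpoly.eq_of_irreducible_of_monic
      (minpoly.irreducible (Algebra.IsIntegral.isIntegral _)) ?_
      (minpoly.monic (Algebra.IsIntegral.isIntegral _))
    rw [Polynomial.aeval_algHom_apply]
    exact h aeval_minpoly_mem_ker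
  rw [NormedAlgebra.norm_eq_spectralNorm K, NormedAlgebra.norm_eq_spectralNorm K, spectralNorm,
    spectralNorm, minpoly_eq]

variable {K : Type*} [Field K] (v : Valuation K ℝ≥0) [v.IsRankOneDiscrete]
  {E : Type*} [Field E] [Algebra K E] [FiniteDimensional K E]

instance finiteDimensional_completion (w : v.extensions E) :
    FiniteDimensional v.Completion w.1.Completion :=
  .of_surjective (tensorToCompletion v w).toLinearMap (tensorToCompletion_surjective v w)

/-- The maximal ideal of `K_v ⊗ E` with residue field `E_w`. -/
noncomputable def maximalIdealOfExtension (w : v.extensions E) :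
    MaximalSpectrum (v.Completion ⊗[K] E) :=
  ⟨RingHom.ker (tensorToCompletion v w),
    RingHom.ker_isMaximal_of_surjective _ (tensorToCompletion_surjective v w)⟩

theorem maximalIdealOfExtension_injective :
    Function.Injective (maximalIdealOfExtension v (E := E)) := by
  intro w w' hww'
  have ker_le : RingHom.ker (tensorToCompletion v w) ≤ RingHom.ker (tensorToCompletion v w') :=
    (congrArg MaximalSpectrum.asIdeal hww').le
  refine Subtype.ext (Valuation.ext fun x ↦ NNReal.coe_injective ?_)
  simpa only [tensorToCompletion_one_tmul, norm_toCompletion] using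
    norm_eq_norm_of_ker_le _ _ ker_le (1 ⊗ₜ x)

theorem exists_extension_ker_tensorToCompletion_eq {F : Type*} [NormedField F]
    [IsUltrametricDist F] [NormedAlgebra v.Completion F]
    (f : v.Completion ⊗[K] E →ₐ[v.Completion] F) :
    ∃ w : v.extensions E, RingHom.ker (tensorToCompletion v w) = RingHom.ker f := by
  have norm_map_algebraMap (x : K) : ‖f (1 ⊗ₜ algebraMap K E x)‖ = v x :=
    calc ‖f (1 ⊗ₜ algebraMap K E x)‖ = ‖f (algebraMap v.Completion _ (v.toCompletion x))‖ :=
          congrArg (‖f ·‖) (Algebra.TensorProduct.includeRight.commutes x)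
      _ = v x := by rw [f.commutes, norm_algebraMap', norm_toCompletion]
  obtain ⟨w, hw⟩ : ∃ w : v.extensions E, ∀ x, (w.1 x : ℝ) = ‖f (1 ⊗ₜ x)‖ :=
    ⟨⟨NormedField.valuation.comap
      ((f : v.Completion ⊗[K] E →+* F).comp Algebra.TensorProduct.includeRight.toRingHom),
      Valuation.ext fun x ↦ NNReal.coe_injective (norm_map_algebraMap x)⟩, fun _ ↦ rfl⟩
  have norm_eq := norm_eq_norm_of_forall_one_tmul (M := w.1.Completion) (denseRange_toCompletion v)
    (tensorToCompletion v w).toLinearMap f.toLinearMap fun x ↦ by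
      simp only [AlgHom.toLinearMap_apply, tensorToCompletion_one_tmul, norm_toCompletion, hw]
  refine ⟨w, Ideal.ext fun z ↦ ?_⟩
  calc tensorToCompletion v w z = 0 ↔ ‖tensorToCompletion v w z‖ = 0 := norm_eq_zero.symm
    _ ↔ ‖f z‖ = 0 := by rw [← AlgHom.toLinearMap_apply, norm_eq, AlgHom.toLinearMap_apply]
    _ ↔ f z = 0 := norm_eq_zero

theorem maximalIdealOfExtension_surjective :
    Function.Surjective (maximalIdealOfExtension v (E := E)) := by
  intro m
  let F := (v.Completion ⊗[K] E) ⧸ m.asIdeal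
  let : Field F := Ideal.Quotient.field m.asIdeal
  let : NormedField F := spectralNorm.normedField v.Completion F
  let : NormedAlgebra v.Completion F := spectralNorm.normedAlgebra v.Completion F
  have : IsUltrametricDist F := .isUltrametricDist_of_isNonarchimedean_norm
    (isNonarchimedean_spectralNorm (K := v.Completion) (L := F))
  obtain ⟨w, hw⟩ := exists_extension_ker_tensorToCompletion_eq v
    (Ideal.Quotient.mkₐ v.Completion m.asIdeal : _ →ₐ[v.Completion] F)
  exact ⟨w, MaximalSpectrum.ext (hw.trans (Ideal.Quotient.mkₐ_ker v.Completion m.asIdeal))⟩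

theorem encard_extensions_le_finSepDegree :
    (v.extensions E).encard ≤ (Field.finSepDegree K E : ℕ∞) :=
  (ENat.card_le_card_of_injective (maximalIdealOfExtension_injective v)).trans
    (card_maximalSpectrum_tensorProduct_le_finSepDegree K E v.Completion)

theorem nonempty_algEquiv_pi_completion [IsReduced (v.Completion ⊗[K] E)] :
    Nonempty ((v.Completion ⊗[K] E) ≃ₐ[v.Completion]
      ((w : v.extensions E) → w.1.Completion)) := by
  have : IsArtinianRing (v.Completion ⊗[K] E) := .of_finite v.Completion _
  let e : v.extensions E ≃ MaximalSpectrum (v.Completion ⊗[K] E) :=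
    .ofBijective (maximalIdealOfExtension v)
      ⟨maximalIdealOfExtension_injective v, maximalIdealOfExtension_surjective v⟩
  exact ⟨((IsArtinianRing.equivPi (v.Completion ⊗[K] E)).restrictScalars v.Completion).trans <|
    (AlgEquiv.piCongrLeft v.Completion
      (fun m : MaximalSpectrum (v.Completion ⊗[K] E) ↦ _ ⧸ m.asIdeal) e).symm.trans <|
    AlgEquiv.piCongrRight fun w ↦
      Ideal.quotientKerAlgEquivOfSurjective (tensorToCompletion_surjective v w)⟩

end MaximalSpectrum

end ValuationExtension

theorem mainTheorem10_general {K E : Type*} [Field K] [Field E] [Algebra K E]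
    [FiniteDimensional K E] (v : Valuation K ℝ≥0) [v.IsRankOneDiscrete] :
    (v.extensions E).encard ≤ (Field.finSepDegree K E : ℕ∞) ∧
      ((Algebra.IsSeparable K E ∨ ValuationExtension.IsFFinite v.valuationSubring) →
        Nonempty ((v.Completion ⊗[K] E) ≃ₐ[v.Completion]
          ((w : v.extensions E) → w.1.Completion))) := by
  refine ⟨ValuationExtension.encard_extensions_le_finSepDegree v, fun h ↦ ?_⟩
  have : IsReduced (v.Completion ⊗[K] E) := by
    rcases h with separable | fFinite
    · exact ValuationExtension.isReduced_tensorProduct_of_isSeparable K E v.Completion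
    · exact ValuationExtension.isReduced_tensorProduct_of_isFFinite v fFinite E
  exact ValuationExtension.nonempty_algEquiv_pi_completion v

theorem mainTheorem10 {K E : Type*} [Field K] [Field.FG K]
    [Field E] [Algebra K E] [FiniteDimensional K E]
    (v : Valuation K ℝ≥0) [v.IsRankOneDiscrete] :
    (v.extensions E).encard ≤ (Field.finSepDegree K E : ℕ∞) ∧
      ((Algebra.IsSeparable K E ∨ Algebra.EssFiniteType ℤ v.valuationSubring) →
        Nonempty ((v.Completion ⊗[K] E) ≃ₐ[v.Completion]
          ((w : v.extensions E) → w.1.Completion))) :=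
  (mainTheorem10_general v).imp_right fun h hv ↦
    h (hv.imp_right ValuationExtension.isFFinite_of_essFiniteType_int)
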